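/- Let $s\ge 1$, let $N\ge 0$ be even, $u\in\mathbb C$, and let $M_a\in\mathbb Z_{\ge0}$ and $v^{(a)}_k\in\mathbb C$ ($1\le a\le s$, $1\le k\le M_a$) be arbitrary (in particular, they may form a solution of the Bethe ansatz equation of the $osp(1|2s)$ quantum transfer matrix). Put $Q_0(v)=1$, $Q_a(v)=\prod_{k=1}^{M_a}(v-v^{(a)}_k)$, $\phi_\pm(v)=(v\pm iu)^{N/2}$, $M_0=N$, and let $J=\{1\prec 2\prec\dots\prec s\prec 0\prec\bar s\prec\dots\prec\bar2\prec\bar1\}$. Put $\zeta_a=\zeta_{\bar a}=(-1)^{M_{a-1}-M_a}$ for $1\le a\le s$ and $$\psi_1(v)=\zeta_1\frac{\phi_+(v)\phi_-(v+i)\phi_+(v-\frac{2s-1}{2}i)}{\phi_+(v-\frac{2s+1}{2}i)},\qquad \psi_{\bar1}(v)=\zeta_{\bar1}\frac{\phi_-(v)\phi_+(v-i)\phi_-(v+\frac{2s-1}{2}i)}{\phi_-(v+\frac{2s+1}{2}i)},$$ $\psi_0(v)=\phi_+(v)\phi_-(v)$, and $\psi_b(v)=\zeta_b\,\phi_+(v)\phi_-(v)$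 for $b\in\{2,\dots,s,\bar s,\dots,\bar 2\}$. For $1\le a\le s$ define the boxes $$z_a(v)=\psi_a(v)\frac{Q_{a-1}(v+\frac i2(a+1))\,Q_a(v+\frac i2(a-2))}{Q_{a-1}(v+\frac i2(a-1))\,Q_a(v+\frac i2a)},\qquad z_0(v)=\psi_0(v)\frac{Q_s(v+\frac i2(s-1))\,Q_s(v+\frac i2(s+2))}{Q_s(v+\frac i2(s+1))\,Q_s(v+\frac i2s)},$$ $$z_{\bar a}(v)=\psi_{\bar a}(v)\frac{Q_{a-1}(v-\frac i2(a-2s))\,Q_a(v-\frac i2(a-2s-3))}{Q_{a-1}(v-\frac i2(a-2s-2))\,Q_a(v-\frac i2(a-2s-1))}.$$ For $a,m\ge0$ let $$\mathcal T^{(a)}_m(v)=\sum_b\prod_{j=1}^m\prod_{k=1}^a z_{b(j,k)}\bigl(v-\tfrac i2(m-a-2j+2k)\bigr),$$ where $b$ runs over all fillings of the rectangle with $m$ rows and $a$ columns by elements of $J$ with $b(j,k)\prec b(j,k+1)$ and $b(j,k)\preceq b(j+1,k)$. Let $$\mathcal N^{(a)}_m(v)=\frac{\prod_{j=1}^m\prod_{k=1}^a\phi_-(v-\frac{m-a-2j+2k}{2}i)\,\phi_+(v-\frac{m-a-2j+2k}{2}i)}{\phi_-(v-\frac{m-a}2i)\,\phi_+(v+\frac{m-a}2i)},\qquad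 T^{(a)}_m(v)=\frac{\mathcal T^{(a)}_m(v)}{\mathcal N^{(a)}_m(v)}.$$ Then the following hold as identities between rational functions of $v$. For all $m\ge1$ and $1\le a\le s-1$, $$T^{(a)}_m(v+\tfrac i2)T^{(a)}_m(v-\tfrac i2)=T^{(a)}_{m+1}(v)T^{(a)}_{m-1}(v)+T^{(a-1)}_m(v)T^{(a+1)}_m(v),$$ and for all $m\ge1$, $$T^{(s)}_m(v+\tfrac i2)T^{(s)}_m(v-\tfrac i2)=T^{(s)}_{m+1}(v)T^{(s)}_{m-1}(v)+g^{(s)}_m(v)T^{(s-1)}_m(v)T^{(s)}_m(v),$$ where $$g^{(s)}_m(v)=\frac{\phi_-(v+\frac{m+s+1}2i)\,\phi_+(v-\frac{m+s+1}2i)}{\phi_-(v+\frac{m+s}2i)\,\phi_+(v-\frac{m+s}2i)},$$ and the boundary functions are $$T^{(a)}_0(v)=\phi_-(v+\tfrac a2i)\,\phi_+(v-\tfrac a2i)\quad(a\ge1),\qquad T^{(0)}_m(v)=\phi_-(v-\tfrac m2i)\,\phi_+(v+\tfrac m2i)\quad(m\ge1).$$ -/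

import Mathlib

open Complex

noncomputable section

/-- The data entering the dressed vacuum forms of the `osp(1|2s)` quantum transfer matrix: the rank
`s`, the Trotter number `N`, the parameter `u`, the numbers `M a` and the complex numbers
`root a k` (`1 ≤ a ≤ s`, `k < M a`); values at other indices are irrelevant. -/
structure OspData where
  s : ℕ
  N : ℕ
  u : ℂ
  M : ℕ → ℕ
  root : ℕ → ℕ → ℂ

namespace OspData

variable (D : OspData) {K : Type*} [Field K] [Algebra ℂ K]

/- All functions of the spectral parameter are given by formulas that make sense in any field
`K` containing `ℂ`.  With `K = RatFunc ℂ` and `v = RatFunc.X` they are rational functions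
of the indeterminate `v`. -/

/-- The complex number `c * i / 2`, as an element of `K`. -/
def hi (K : Type*) [Field K] [Algebra ℂ K] (c : ℤ) : K := algebraMap ℂ K ((c : ℂ) * I / 2)

/-- `Q_0 = 1`, and `Q_a(x) = ∏_k (x - v_k^{(a)})` for `a ≥ 1`. -/
def Q (a : ℕ) (x : K) : K :=
  if a = 0 then 1 else ∏ k ∈ Finset.range (D.M a), (x - algebraMap ℂ K (D.root a k))

/-- `φ₊(x) = (x + i u)^{N/2}`. -/
def phiP (x : K) : K := (x + algebraMap ℂ K (I * D.u)) ^ (D.N / 2)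

/-- `φ₋(x) = (x - i u)^{N/2}`. -/
def phiM (x : K) : K := (x - algebraMap ℂ K (I * D.u)) ^ (D.N / 2)

/-- The phase factor `ζ_a = ζ_{ā}` for `1 ≤ a ≤ s` (and `ζ_0 = 1`). -/
def zeta (K : Type*) [Field K] (a : ℕ) : K :=
  if a = 1 then (-1) ^ ((D.N : ℤ) - D.M 1) else (-1) ^ ((D.M (a - 1) : ℤ) - D.M a)

/-- The vacuum part `ψ_a`, `1 ≤ a ≤ s`. -/
def psi (a : ℕ) (v : K) : K :=
  D.zeta K a *
    if a = 1 then
      D.phiP v * D.phiM (v + hi K 2) * D.phiP (v - hi K (2 * D.s - 1))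
        / D.phiP (v - hi K (2 * D.s + 1))
    else D.phiP v * D.phiM v

/-- The vacuum part `ψ_0`. -/
def psiZero (v : K) : K := D.phiP v * D.phiM v

/-- The vacuum part `ψ_{ā}`, `1 ≤ a ≤ s`. -/
def psiBar (a : ℕ) (v : K) : K :=
  D.zeta K a *
    if a = 1 then
      D.phiM v * D.phiP (v - hi K 2) * D.phiM (v + hi K (2 * D.s - 1))
        / D.phiM (v + hi K (2 * D.s + 1))
    else D.phiP v * D.phiM v

/-- The box with entry `a`, `1 ≤ a ≤ s`. -/
def boxPlain (a : ℕ) (v : K) : K :=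
  D.psi a v *
    ((D.Q (a - 1) (v + hi K (a + 1)) * D.Q a (v + hi K (a - 2)))
      / (D.Q (a - 1) (v + hi K (a - 1)) * D.Q a (v + hi K a)))

/-- The box with entry `0`. -/
def boxZero (v : K) : K :=
  D.psiZero v *
    ((D.Q D.s (v + hi K (D.s - 1)) * D.Q D.s (v + hi K (D.s + 2)))
      / (D.Q D.s (v + hi K (D.s + 1)) * D.Q D.s (v + hi K D.s)))

/-- The box with entry `ā`, `1 ≤ a ≤ s`. -/
def boxBar (a : ℕ) (v : K) : K :=
  D.psiBar a v *
    ((D.Q (a - 1) (v - hi K (a - 2 * D.s)) * D.Q a (v - hi K (a - 2 * D.s - 3)))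
      / (D.Q (a - 1) (v - hi K (a - 2 * D.s - 2)) * D.Q a (v - hi K (a - 2 * D.s - 1))))

/-- The ordered alphabet `1 ≺ 2 ≺ ⋯ ≺ s ≺ 0 ≺ s̄ ≺ ⋯ ≺ 2̄ ≺ 1̄`, identified with
`0 < 1 < ⋯ < 2s` through the position of a letter. -/
abbrev Letter : Type := Fin (2 * D.s + 1)

/-- The box with a given letter: position `p < s` is the letter `p + 1`, position `s` is the
letter `0`, and position `p > s` is the letter `ā` with `a = 2s + 1 - p`. -/
def box (p : D.Letter) (v : K) : K :=
  if (p : ℕ) < D.s then D.boxPlain ((p : ℕ) + 1) v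
  else if (p : ℕ) = D.s then D.boxZero v
  else D.boxBar (2 * D.s + 1 - (p : ℕ)) v

/-- Admissible tableaux on the rectangle with `m` rows and `a` columns: strictly increasing
along rows, weakly increasing down columns. -/
def Admissible {m a : ℕ} (b : Fin m → Fin a → D.Letter) : Prop :=
  (∀ i, StrictMono (b i)) ∧ ∀ j, Monotone fun i => b i j

open Classical in
/-- The dressed vacuum form of the rectangle `(a^m)` (`m` rows, `a` columns).  Rows and columns
are counted from `0` instead of `1`, which does not change `-2j+2k`. -/
def dvf (a m : ℕ) (v : K) : K :=
  ∑ b : Fin m → Fin a → D.Letter with D.Admissible b,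
    ∏ j : Fin m, ∏ k : Fin a,
      D.box (b j k) (v - hi K (-(a : ℤ) + m - 2 * (j : ℕ) + 2 * (k : ℕ)))

/-- The normalisation function `𝒩^{(a)}_m`. -/
def norm (a m : ℕ) (v : K) : K :=
  (∏ j : Fin m, ∏ k : Fin a,
      (D.phiM (v - hi K ((m : ℤ) - a - 2 * (j : ℕ) + 2 * (k : ℕ)))
        * D.phiP (v - hi K ((m : ℤ) - a - 2 * (j : ℕ) + 2 * (k : ℕ)))))
    / (D.phiM (v - hi K ((m : ℤ) - a)) * D.phiP (v + hi K ((m : ℤ) - a)))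

/-- The normalised function `T^{(a)}_m`. -/
def T (a m : ℕ) (v : K) : K := D.dvf a m v / D.norm a m v

/-- The function `g^{(s)}_m`. -/
def g (m : ℕ) (v : K) : K :=
  (D.phiM (v + hi K (m + D.s + 1)) * D.phiP (v - hi K (m + D.s + 1)))
    / (D.phiM (v + hi K (m + D.s)) * D.phiP (v - hi K (m + D.s)))

end OspData

end

/-! ### The Desnanot–Jacobi identity. -/

namespace Matrix

variable {K : Type*} [Field K]

section
variable {n : Type*} [Fintype n] [DecidableEq n]

/-! The Bethe ansatz equation plays no role: everything follows from the form of the boxes.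
Replacing `Q_0` by a suitable product of shifted `φ₋` and `φ₊` (`dressedQ`) absorbs the vacuum parts
up to signs and a common factor `φ₊φ₋` per box. The normalisation cancels these factors, so `T` is a
tableau sum times two explicit `φ`'s (`T_eq`).

A Jacobi–Trudi formula, valid for arbitrary weights depending on the letter and the content
(`sum_rectangle_eq_jacobiTrudi`), turns the tableau sum into a determinant of one-row sums.
Desnanot–Jacobi applied to it (`jacobiTrudi_rectangle_mul`) gives the T-system for all `a ≥ 1`, with
no truncation.

What closes the system at `a = s` is a duality. One-row sums of degrees `r` and `2s + 1 - r` are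
proportional (`elemSum_ospLetter_dual`), by induction on the alphabet, peeling off the outer pair
`k+1` and its bar. The ratio splits into a row factor and a column factor, so rectangles of widths
`a` and `2s + 1 - a` have proportional determinants (`jacobiTrudi_ospLetter_dual`). For `a = s + 1`
this is `T^{(s+1)} = g T^{(s)}` (`T_succ_s`). -/

/-- The matrix `P` bordered by one column, one row and one corner entry. -/
def bordered {R : Type*} (P : Matrix n n R) (q r : n → R) (x : R) :
    Matrix (n ⊕ Unit) (n ⊕ Unit) R :=
  fromBlocks P (of fun i _ => q i) (of fun _ j => r j) (of fun _ _ => x)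

/-- Each bordered determinant is `P.det` times an entry of the Schur complement, and the full
determinant is `P.det` times its 2×2 determinant. -/
theorem det_mul_det_fromBlocks_of_det_ne_zero (P : Matrix n n K) (Q : Matrix n (Fin 2) K)
    (R : Matrix (Fin 2) n K) (S : Matrix (Fin 2) (Fin 2) K) (hP : P.det ≠ 0) :
    P.det * (fromBlocks P Q R S).det =
      (bordered P (fun a => Q a 0) (R 0) (S 0 0)).det
          * (bordered P (fun a => Q a 1) (R 1) (S 1 1)).det
        - (bordered P (fun a => Q a 1) (R 0) (S 0 1)).det
          * (bordered P (fun a => Q a 0) (R 1) (S 1 0)).det := by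
  have : Invertible P := P.invertibleOfIsUnitDet (isUnit_iff_ne_zero.2 hP)
  have key : ∀ i j, (bordered P (fun a => Q a j) (R i) (S i j)).det
      = P.det * (S - R * ⅟P * Q) i j := by
    intro i j
    rw [bordered, det_fromBlocks₁₁, det_unique (n := Unit)]
    simp [mul_apply]
  rw [key, key, key, key, det_fromBlocks₁₁, det_fin_two]
  ring

open Polynomial in
-- The invertible case over `RatFunc K`, applied to the perturbation `X + P` and then specialised to
-- `X = 0`.
theorem det_mul_det_fromBlocks (P : Matrix n n K) (Q : Matrix n (Fin 2) K)
    (R : Matrix (Fin 2) n K) (S : Matrix (Fin 2) (Fin 2) K) :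
    P.det * (fromBlocks P Q R S).det =
      (bordered P (fun a => Q a 0) (R 0) (S 0 0)).det
          * (bordered P (fun a => Q a 1) (R 1) (S 1 1)).det
        - (bordered P (fun a => Q a 1) (R 0) (S 0 1)).det
          * (bordered P (fun a => Q a 0) (R 1) (S 1 0)).det := by
  have hbord : ∀ {A B : Type _} [CommRing A] [CommRing B] (f : A →+* B) (P : Matrix n n A)
      (q r : n → A) (x : A), f (bordered P q r x).det
        = (bordered (P.map f) (f ∘ q) (f ∘ r) (f x)).det := by
    intro A B _ _ f P q r x
    rw [f.map_det]
    congr 1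
    ext (i | i) (j | j) <;> rfl
  have hfb : ∀ {A B : Type _} [CommRing A] [CommRing B] (f : A →+* B) (P : Matrix n n A)
      (Q : Matrix n (Fin 2) A) (R : Matrix (Fin 2) n A) (S : Matrix (Fin 2) (Fin 2) A),
      f (fromBlocks P Q R S).det
        = (fromBlocks (P.map f) (Q.map f) (R.map f) (S.map f)).det := by
    intro A B _ _ f P Q R S
    rw [f.map_det]
    congr 1
    ext (i | i) (j | j) <;> rfl
  -- The characteristic matrix of `-P` is `X + P`: its determinant is monic, hence nonzero, and it
  -- equals `P` at `X = 0`.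
  let P' : Matrix n n K[X] := (-P).charmatrix
  have hP' : P'.det ≠ 0 := (charpoly_monic (-P)).ne_zero
  have hpoly : P'.det * (fromBlocks P' (Q.map C) (R.map C) (S.map C)).det =
      (bordered P' (fun a => C (Q a 0)) (fun a => C (R 0 a)) (C (S 0 0))).det
          * (bordered P' (fun a => C (Q a 1)) (fun a => C (R 1 a)) (C (S 1 1))).det
        - (bordered P' (fun a => C (Q a 1)) (fun a => C (R 0 a)) (C (S 0 1))).det
          * (bordered P' (fun a => C (Q a 0)) (fun a => C (R 1 a)) (C (S 1 0))).det := by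
    have hinj := FaithfulSMul.algebraMap_injective K[X] (RatFunc K)
    apply hinj
    rw [map_mul, map_sub, map_mul, map_mul, hfb, hbord, hbord, hbord, hbord, RingHom.map_det]
    exact det_mul_det_fromBlocks_of_det_ne_zero _ _ _ _
      (by
        have h2 := (map_ne_zero_iff _ hinj).2 hP'
        rwa [RingHom.map_det] at h2)
  have h0 := congrArg (evalRingHom (0 : K)) hpoly
  rw [map_mul, map_sub, map_mul, map_mul, hfb, hbord, hbord, hbord, hbord, RingHom.map_det] at h0
  have e1 : P'.map (evalRingHom (0 : K)) = P := by
    ext i j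
    by_cases hij : i = j
    · subst hij; simp [P']
    · simp [P', charmatrix_apply_ne _ _ _ hij]
  have e2 : (Q.map C).map (evalRingHom (0 : K)) = Q := by ext; simp
  have e2' : (R.map C).map (evalRingHom (0 : K)) = R := by ext; simp
  have e2'' : (S.map C).map (evalRingHom (0 : K)) = S := by ext; simp
  rw [RingHom.mapMatrix_apply, e1, e2, e2', e2''] at h0
  simp only [Function.comp_def, coe_evalRingHom, eval_C] at h0
  exact h0

end

/-- The two reindexings differ from the identity by mutually inverse permutations, whose signs
cancel. This handles the off-diagonal minors below. -/
theorem det_submatrix_mul_det_submatrix {m n : Type*} [Fintype m] [DecidableEq m] [Fintype n]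
    [DecidableEq n] (e f : m ≃ n) (A B : Matrix n n K) :
    (A.submatrix e f).det * (B.submatrix f e).det = A.det * B.det := by
  have h : ∀ (e f : m ≃ n) (A : Matrix n n K),
      (A.submatrix e f).det = Equiv.Perm.sign (f.symm.trans e) * A.det := by
    intro e f A
    rw [← det_permute, ← det_submatrix_equiv_self f]
    congr 1
    ext i j
    simp
  rw [h, h]
  have : (Equiv.Perm.sign (f.symm.trans e) : ℤˣ) * Equiv.Perm.sign (e.symm.trans f) = 1 := by
    rw [← Equiv.Perm.sign_mul]
    convert Equiv.Perm.sign_one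
    ext i
    simp
  have h2 : (((Equiv.Perm.sign (f.symm.trans e) : ℤˣ) : ℤ) : K)
      * ((Equiv.Perm.sign (e.symm.trans f) : ℤˣ) : ℤ) = 1 := by
    rw [← Int.cast_mul, ← Units.val_mul, this]; simp
  linear_combination A.det * B.det * h2

/-- The **Desnanot–Jacobi identity**. -/
theorem desnanot_jacobi {m : ℕ} (A : Matrix (Fin (m + 2)) (Fin (m + 2)) K) :
    (A.submatrix Fin.succ Fin.succ).det * (A.submatrix Fin.castSucc Fin.castSucc).det
      = A.det * (A.submatrix (fun i : Fin m => i.succ.castSucc) fun j => j.succ.castSucc).det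
        + (A.submatrix Fin.succ Fin.castSucc).det * (A.submatrix Fin.castSucc Fin.succ).det := by
  let f : Fin m ⊕ Fin 2 → Fin (m + 2) :=
    Sum.elim (fun i => i.succ.castSucc) ![0, Fin.last (m + 1)]
  have hf : Function.Injective f := by
    rintro (i | i) (j | j) h
    · simpa [f] using h
    · fin_cases j <;> simp [f, Fin.ext_iff] at h
      omega
    · fin_cases i <;> simp [f, Fin.ext_iff] at h
      omega
    · fin_cases i <;> fin_cases j <;> simp [f, Fin.ext_iff] at h ⊢
  let e : Fin m ⊕ Fin 2 ≃ Fin (m + 2) :=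
    Equiv.ofBijective f ((Fintype.bijective_iff_injective_and_card f).2 ⟨hf, by simp⟩)
  -- `e₀` puts the border index first and `e₁` puts it last, matching the minors that keep row or
  -- column `0`, respectively the last one.
  let e₀ : Fin m ⊕ Unit ≃ Fin (m + 1) :=
    (Equiv.optionEquivSumPUnit (Fin m)).symm.trans (finSuccEquiv m).symm
  let e₁ : Fin m ⊕ Unit ≃ Fin (m + 1) :=
    (Equiv.optionEquivSumPUnit (Fin m)).symm.trans finSuccEquivLast.symm
  have key := det_mul_det_fromBlocks
    (A.submatrix (fun i : Fin m => i.succ.castSucc) fun j => j.succ.castSucc)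
    (A.submatrix (fun i : Fin m => i.succ.castSucc) ![0, Fin.last (m + 1)])
    (A.submatrix ![0, Fin.last (m + 1)] fun j : Fin m => j.succ.castSucc)
    (A.submatrix ![0, Fin.last (m + 1)] ![0, Fin.last (m + 1)])
  have hA : fromBlocks
    (A.submatrix (fun i : Fin m => i.succ.castSucc) fun j => j.succ.castSucc)
    (A.submatrix (fun i : Fin m => i.succ.castSucc) ![0, Fin.last (m + 1)])
    (A.submatrix ![0, Fin.last (m + 1)] fun j : Fin m => j.succ.castSucc)
    (A.submatrix ![0, Fin.last (m + 1)] ![0, Fin.last (m + 1)]) = A.submatrix e e := by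
    ext (i | i) (j | j) <;> rfl
  rw [hA, det_submatrix_equiv_self] at key
  have b00 : bordered (A.submatrix (fun i : Fin m => i.succ.castSucc) fun j => j.succ.castSucc)
      (fun a => A a.succ.castSucc 0) (fun b => A 0 b.succ.castSucc) (A 0 0)
      = (A.submatrix Fin.castSucc Fin.castSucc).submatrix e₀ e₀ := by
    ext (i | i) (j | j) <;> simp [bordered, e₀]
  have b01 : bordered (A.submatrix (fun i : Fin m => i.succ.castSucc) fun j => j.succ.castSucc)
      (fun a => A a.succ.castSucc (Fin.last (m + 1))) (fun b => A 0 b.succ.castSucc)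
      (A 0 (Fin.last (m + 1)))
      = (A.submatrix Fin.castSucc Fin.succ).submatrix e₀ e₁ := by
    ext (i | i) (j | j) <;> simp [bordered, e₀, e₁]
  have b10 : bordered (A.submatrix (fun i : Fin m => i.succ.castSucc) fun j => j.succ.castSucc)
      (fun a => A a.succ.castSucc 0) (fun b => A (Fin.last (m + 1)) b.succ.castSucc)
      (A (Fin.last (m + 1)) 0)
      = (A.submatrix Fin.succ Fin.castSucc).submatrix e₁ e₀ := by
    ext (i | i) (j | j) <;> simp [bordered, e₀, e₁]
  have b11 : bordered (A.submatrix (fun i : Fin m => i.succ.castSucc) fun j => j.succ.castSucc)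
      (fun a => A a.succ.castSucc (Fin.last (m + 1)))
      (fun b => A (Fin.last (m + 1)) b.succ.castSucc)
      (A (Fin.last (m + 1)) (Fin.last (m + 1)))
      = (A.submatrix Fin.succ Fin.succ).submatrix e₁ e₁ := by
    ext (i | i) (j | j) <;> simp [bordered, e₁]
  change _ = (bordered _ (fun a : Fin m => A a.succ.castSucc 0) (fun b : Fin m => A 0 b.succ.castSucc)
      (A 0 0)).det
      * (bordered _ (fun a : Fin m => A a.succ.castSucc (Fin.last (m + 1)))
        (fun b : Fin m => A (Fin.last (m + 1)) b.succ.castSucc)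
        (A (Fin.last (m + 1)) (Fin.last (m + 1)))).det
      - (bordered _ (fun a : Fin m => A a.succ.castSucc (Fin.last (m + 1)))
          (fun b : Fin m => A 0 b.succ.castSucc) (A 0 (Fin.last (m + 1)))).det
        * (bordered _ (fun a : Fin m => A a.succ.castSucc 0)
          (fun b : Fin m => A (Fin.last (m + 1)) b.succ.castSucc) (A (Fin.last (m + 1)) 0)).det at key
  rw [b00, b01, b10, b11, det_submatrix_equiv_self, det_submatrix_equiv_self,
    det_submatrix_mul_det_submatrix] at key
  linear_combination -key

end Matrix

/-! ### Jacobi–Trudi formula and T-system for content-dependent weights. -/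

section Tableaux

variable {K : Type*} [Field K]

/-- The sum over `p_0 < ⋯ < p_{r-1} < n` of `∏ k, y p_k (w - 2 k)`, zero for `r < 0`. -/
def elemSum (y : ℕ → ℤ → K) : ℕ → ℤ → ℤ → K
  | 0, r, _ => if r = 0 then 1 else 0
  | n + 1, r, w => elemSum y n r w + y n (w - 2 * (r - 1)) * elemSum y n (r - 1) w

theorem elemSum_zero (y : ℕ → ℤ → K) (r w : ℤ) :
    elemSum y 0 r w = if r = 0 then 1 else 0 := rfl

theorem elemSum_succ (y : ℕ → ℤ → K) (n : ℕ) (r w : ℤ) :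
    elemSum y (n + 1) r w
      = elemSum y n r w + y n (w - 2 * (r - 1)) * elemSum y n (r - 1) w := rfl

theorem elemSum_succ' (y : ℕ → ℤ → K) (n : ℕ) (r w : ℤ) :
    elemSum y (n + 1) r w = elemSum (fun p => y (p + 1)) n r w
      + y 0 w * elemSum (fun p => y (p + 1)) n (r - 1) (w - 2) := by
  induction n generalizing r with
  | zero =>
    simp only [elemSum_succ, elemSum_zero, sub_eq_zero]
    by_cases h : r = 1
    · subst h; simp
    · simp [h]
  | succ n ih =>
    rw [elemSum_succ, ih, ih, elemSum_succ, elemSum_succ _ n (r - 1),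
      show w - 2 - 2 * (r - 1 - 1) = w - 2 * (r - 1) by ring]
    ring

/-- The Jacobi–Trudi determinant of the shape with rows `l i`. -/
def jacobiTrudi (y : ℕ → ℤ → K) (n : ℕ) {m : ℕ} (l : Fin m → ℤ) (u : ℤ) : K :=
  (Matrix.of fun i j : Fin m => elemSum y n (l i - i + j) (u + 2 * j)).det

/-- The rows `l` with the last box of each row in `s` removed. -/
def removeBoxes {m : ℕ} (l : Fin m → ℤ) (s : Finset (Fin m)) : Fin m → ℤ :=
  fun i => if i ∈ s then l i - 1 else l i

/-- The letter `n` enters entry `(i, j)` at the argument `u + 2 (i - l i + 1)`, independent of `j`.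
Each row is thus a sum of two rows, one with a scalar pulled out, and multilinearity expands over
the rows that contain this letter. -/
theorem jacobiTrudi_succ (y : ℕ → ℤ → K) (n : ℕ) {m : ℕ} (l : Fin m → ℤ) (u : ℤ) :
    jacobiTrudi y (n + 1) l u = ∑ s : Finset (Fin m),
      (∏ i ∈ s, y n (u + 2 * (i - l i + 1))) * jacobiTrudi y n (removeBoxes l s) u := by
  let A : Fin m → Fin m → K := fun i j =>
    y n (u + 2 * (i - l i + 1)) * elemSum y n (l i - 1 - i + j) (u + 2 * j)
  let B : Fin m → Fin m → K := fun i j => elemSum y n (l i - i + j) (u + 2 * j)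
  have hAB : jacobiTrudi y (n + 1) l u = Matrix.detRowAlternating (A + B) := by
    rw [jacobiTrudi]
    congr 1
    ext i j
    simp only [Matrix.of_apply, Pi.add_apply, A, B, elemSum_succ]
    rw [add_comm, show l i - (i : ℤ) + j - 1 = l i - 1 - i + j by ring,
      show u + 2 * (j : ℤ) - 2 * (l i - 1 - i + j) = u + 2 * (i - l i + 1) by ring]
  rw [hAB, AlternatingMap.map_add_univ]
  refine Finset.sum_congr rfl fun s _ => ?_
  have hprod : ∏ i ∈ s, y n (u + 2 * (i - l i + 1))
      = ∏ i, if i ∈ s then y n (u + 2 * (i - l i + 1)) else 1 := by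
    rw [Finset.prod_ite_mem, Finset.univ_inter]
  rw [hprod, jacobiTrudi, ← Matrix.det_mul_column]
  change Matrix.det _ = _
  congr 1
  ext i j
  by_cases hi : i ∈ s <;> simp [hi, A, B, removeBoxes]

theorem jacobiTrudi_zero (y : ℕ → ℤ → K) {m : ℕ} (l : Fin m → ℤ) (hl : Antitone l) (u : ℤ) :
    jacobiTrudi y 0 l u = if l = 0 then 1 else 0 := by
  split_ifs with h
  · subst h
    rw [jacobiTrudi, ← Matrix.det_one (n := Fin m)]
    congr 1
    ext i j
    have : (0 - (i : ℤ) + j = 0) ↔ i = j := by omega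
    simp only [Matrix.of_apply, Pi.zero_apply, elemSum_zero, this, Matrix.one_apply]
  · obtain ⟨k, hk⟩ : ∃ k, l k ≠ 0 := by
      by_contra! hc
      exact h (funext hc)
    rcases lt_or_gt_of_ne hk with hk | hk
    -- A negative part forces the last part to be negative, so the last row vanishes; a positive one
    -- forces the first row to vanish.
    · have hm : m - 1 < m := by have := k.2; omega
      apply Matrix.det_eq_zero_of_row_eq_zero (⟨m - 1, hm⟩ : Fin m)
      intro j
      have h1 : l ⟨m - 1, hm⟩ ≤ l k := hl (Fin.le_def.2 (by have := k.2; simp; omega))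
      rw [Matrix.of_apply, elemSum_zero, if_neg]
      have := j.2
      simp only
      omega
    · have hm : 0 < m := by have := k.2; omega
      apply Matrix.det_eq_zero_of_row_eq_zero (⟨0, hm⟩ : Fin m)
      intro j
      have h1 : l k ≤ l ⟨0, hm⟩ := hl (Fin.le_def.2 (Nat.zero_le _))
      rw [Matrix.of_apply, elemSum_zero, if_neg]
      simp only
      omega

/-- Order can fail only where two equal neighbouring parts become `x - 1`, `x`; the corresponding
rows of the matrix then coincide. -/
theorem jacobiTrudi_removeBoxes_eq_zero (y : ℕ → ℤ → K) (n : ℕ) {m : ℕ} (l : Fin m → ℤ)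
    (hl : Antitone l) (s : Finset (Fin m)) (hs : ¬ Antitone (removeBoxes l s)) (u : ℤ) :
    jacobiTrudi y n (removeBoxes l s) u = 0 := by
  cases m with
  | zero => exact absurd (fun i => i.elim0) hs
  | succ m =>
    rw [Fin.antitone_iff_succ_le] at hs
    push Not at hs
    obtain ⟨i, hi⟩ := hs
    have h1 := hl (Fin.castSucc_lt_succ (i := i)).le
    have h2 : removeBoxes l s i.succ = removeBoxes l s i.castSucc + 1 := by
      simp only [removeBoxes] at hi ⊢
      split_ifs at hi ⊢ <;> omega
    refine Matrix.det_zero_of_row_eq (Fin.castSucc_lt_succ (i := i)).ne ?_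
    ext j
    simp only [Matrix.of_apply, h2, Fin.val_castSucc, Fin.val_succ]
    congr 1
    push_cast
    ring

/-- The number of letters below `p` in row `j`, where `S q` is the set of rows containing `q`. -/
def rowCount {n m : ℕ} (S : Fin n → Finset (Fin m)) (p : ℕ) (j : Fin m) : ℤ :=
  ((Finset.univ.filter fun q : Fin n => (q : ℕ) < p ∧ j ∈ S q).card : ℤ)

/-- `S` describes a tableau of shape `l`. -/
def IsTableau {n m : ℕ} (l : Fin m → ℤ) (S : Fin n → Finset (Fin m)) : Prop :=
  (∀ p ≤ n, Antitone (rowCount S p)) ∧ rowCount S n = l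

/-- The weight of the tableau described by `S`. -/
def tableauWeight (y : ℕ → ℤ → K) {n m : ℕ} (u : ℤ) (S : Fin n → Finset (Fin m)) : K :=
  ∏ p, ∏ j ∈ S p, y p (u + 2 * (j - rowCount S p j))

theorem rowCount_snoc {n m : ℕ} (S : Fin n → Finset (Fin m)) (s : Finset (Fin m)) {p : ℕ}
    (hp : p ≤ n) :
    rowCount (Fin.snoc S s : Fin (n + 1) → Finset (Fin m)) p = rowCount S p := by
  ext j
  rw [rowCount, rowCount, Finset.card_filter, Finset.card_filter, Fin.sum_univ_castSucc]
  simp [Nat.not_lt.2 hp]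

theorem rowCount_snoc_last {n m : ℕ} (S : Fin n → Finset (Fin m)) (s : Finset (Fin m))
    (j : Fin m) :
    rowCount (Fin.snoc S s : Fin (n + 1) → Finset (Fin m)) (n + 1) j
      = rowCount S n j + if j ∈ s then 1 else 0 := by
  rw [rowCount, rowCount, Finset.card_filter, Finset.card_filter, Fin.sum_univ_castSucc]
  have : ∀ i : Fin n, (i : ℕ) < n + 1 := fun i => by omega
  simp [this]

theorem isTableau_snoc {n m : ℕ} {l : Fin m → ℤ} (hl : Antitone l) (S : Fin n → Finset (Fin m))
    (s : Finset (Fin m)) :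
    IsTableau l (Fin.snoc S s : Fin (n + 1) → Finset (Fin m)) ↔ IsTableau (removeBoxes l s) S := by
  have key : rowCount (Fin.snoc S s : Fin (n + 1) → Finset (Fin m)) (n + 1) = l
      ↔ rowCount S n = removeBoxes l s := by
    simp only [funext_iff, rowCount_snoc_last, removeBoxes]
    refine forall_congr' fun j => ?_
    split_ifs <;> omega
  rw [IsTableau, IsTableau, key]
  refine and_congr_left fun h => ⟨fun H p hp => ?_, fun H p hp => ?_⟩
  · rw [← rowCount_snoc S s hp]
    exact H p (by omega)
  · rcases Nat.lt_or_ge n p with h1 | h1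
    · obtain rfl : p = n + 1 := by omega
      rw [key.2 h]
      exact hl
    · rw [rowCount_snoc S s h1]
      exact H p h1

theorem tableauWeight_snoc (y : ℕ → ℤ → K) {n m : ℕ} (u : ℤ) (S : Fin n → Finset (Fin m))
    (s : Finset (Fin m)) :
    tableauWeight y u (Fin.snoc S s : Fin (n + 1) → Finset (Fin m))
      = (∏ j ∈ s, y n (u + 2 * (j - rowCount S n j))) * tableauWeight y u S := by
  rw [tableauWeight, Fin.prod_univ_castSucc, mul_comm, tableauWeight]
  congr 1
  · simp [rowCount_snoc S s le_rfl]
  · refine Finset.prod_congr rfl fun p _ => ?_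
    simp [rowCount_snoc S s p.2.le]

open Classical in
-- Both sides obey the same recursion on removing the largest letter; the removals that do not leave
-- a partition contribute zero to each.
theorem sum_tableauWeight (y : ℕ → ℤ → K) (n : ℕ) {m : ℕ} (l : Fin m → ℤ) (hl : Antitone l)
    (u : ℤ) :
    ∑ S : Fin n → Finset (Fin m) with IsTableau l S, tableauWeight y u S
      = jacobiTrudi y n l u := by
  induction n generalizing l with
  | zero =>
    rw [jacobiTrudi_zero y l hl, Finset.sum_filter, Fintype.sum_unique]
    have h0 : ∀ (S : Fin 0 → Finset (Fin m)) p, rowCount S p = 0 := by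
      intro S p; ext j; simp [rowCount]
    have : ∀ S : Fin 0 → Finset (Fin m), IsTableau l S ↔ l = 0 := by
      intro S
      rw [IsTableau, h0]
      refine ⟨fun h => h.2.symm, fun h => ⟨fun p _ => ?_, h.symm⟩⟩
      rw [h0]
      exact antitone_const
    by_cases h : l = 0
    · rw [if_pos h, if_pos ((this _).2 h)]
      simp [tableauWeight]
    · rw [if_neg h, if_neg (mt (this _).1 h)]
  | succ n ih =>
    rw [jacobiTrudi_succ, Finset.sum_filter,
      ← Equiv.sum_comp (Fin.snocEquiv fun _ : Fin (n + 1) => Finset (Fin m)),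
      Fintype.sum_prod_type]
    refine Finset.sum_congr rfl fun s _ => ?_
    have h1 : ∑ S : Fin n → Finset (Fin m) with IsTableau (removeBoxes l s) S, tableauWeight y u S
        = jacobiTrudi y n (removeBoxes l s) u := by
      by_cases h : Antitone (removeBoxes l s)
      · exact ih _ h
      · rw [jacobiTrudi_removeBoxes_eq_zero y n l hl s h, Finset.filter_false_of_mem,
          Finset.sum_empty]
        intro S _ hS
        exact h (hS.2 ▸ hS.1 n le_rfl)
    rw [← h1, Finset.mul_sum, Finset.sum_filter]
    refine Finset.sum_congr rfl fun S _ => ?_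
    have hsnoc : Fin.snocEquiv (fun _ : Fin (n + 1) => Finset (Fin m)) (s, S) = Fin.snoc S s := rfl
    rw [hsnoc]
    by_cases hS : IsTableau (removeBoxes l s) S
    · rw [if_pos hS, if_pos ((isTableau_snoc hl S s).2 hS), tableauWeight_snoc]
      congr 1
      refine Finset.prod_congr rfl fun j hj => ?_
      rw [hS.2, removeBoxes, if_pos hj]
      congr 1
      ring
    · rw [if_neg hS, if_neg (mt (isTableau_snoc hl S s).1 hS)]

/-! ### Fillings of a rectangle as sequences of row sets. -/

/-- The set of rows of `b` containing the letter `p`. -/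
def rowsContaining {m a n : ℕ} (b : Fin m → Fin a → Fin n) (p : Fin n) : Finset (Fin m) :=
  Finset.univ.filter fun j => ∃ k, b j k = p

theorem rowCount_rowsContaining {m a n : ℕ} (b : Fin m → Fin a → Fin n)
    (hb : ∀ j, StrictMono (b j)) (p : ℕ) (j : Fin m) :
    rowCount (rowsContaining b) p j
      = ((Finset.univ.filter fun k : Fin a => (b j k : ℕ) < p).card : ℤ) := by
  rw [rowCount, ← Finset.card_map ⟨b j, (hb j).injective⟩]
  congr 2
  ext q
  simp only [rowsContaining, Finset.mem_filter, Finset.mem_univ, true_and, Finset.mem_map,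
    Function.Embedding.coeFn_mk]
  constructor
  · rintro ⟨h, k, rfl⟩
    exact ⟨k, h, rfl⟩
  · rintro ⟨k, h, rfl⟩
    exact ⟨h, k, rfl⟩

theorem rowCount_rowsContaining_apply {m a n : ℕ} (b : Fin m → Fin a → Fin n)
    (hb : ∀ j, StrictMono (b j)) (j : Fin m) (k : Fin a) :
    rowCount (rowsContaining b) (b j k) j = k := by
  rw [rowCount_rowsContaining b hb]
  have : (Finset.univ.filter fun k' : Fin a => (b j k' : ℕ) < b j k) = Finset.Iio k := by
    ext k'
    simp [(hb j).lt_iff_lt]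
  rw [this, Fin.card_Iio]

theorem rowCount_rowsContaining_last {m a n : ℕ} (b : Fin m → Fin a → Fin n)
    (hb : ∀ j, StrictMono (b j)) (j : Fin m) : rowCount (rowsContaining b) n j = a := by
  rw [rowCount_rowsContaining b hb]
  simp

/-- Columns increase weakly exactly when, for each `p`, the number of entries below `p` does not
grow from one row to the next. -/
theorem isTableau_rowsContaining {m a n : ℕ} (b : Fin m → Fin a → Fin n)
    (hb : ∀ j, StrictMono (b j)) :
    IsTableau (fun _ => (a : ℤ)) (rowsContaining b) ↔ ∀ k, Monotone fun j => b j k := by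
  constructor
  · rintro ⟨h, -⟩ k j j' hj
    by_contra! hlt
    have h1 := h (b j k) (b j k).2.le hj
    rw [rowCount_rowsContaining_apply b hb, rowCount_rowsContaining b hb, Nat.cast_le] at h1
    have h2 : Finset.Iic k ⊆ Finset.univ.filter fun k' : Fin a => (b j' k' : ℕ) < b j k := by
      intro k' hk'
      rw [Finset.mem_Iic] at hk'
      simpa using ((hb j').monotone hk').trans_lt hlt
    have h3 := Finset.card_le_card h2
    rw [Fin.card_Iic] at h3
    omega
  · intro h
    refine ⟨fun p _ j j' hj => ?_, funext fun j => rowCount_rowsContaining_last b hb j⟩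
    rw [rowCount_rowsContaining b hb, rowCount_rowsContaining b hb, Nat.cast_le]
    refine Finset.card_le_card fun k hk => ?_
    simp only [Finset.mem_filter, Finset.mem_univ, true_and] at hk ⊢
    exact lt_of_le_of_lt (Fin.le_def.1 (h k hj)) hk

theorem tableauWeight_rowsContaining (y : ℕ → ℤ → K) {m a n : ℕ} (b : Fin m → Fin a → Fin n)
    (hb : ∀ j, StrictMono (b j)) (u : ℤ) :
    tableauWeight y u (rowsContaining b) = ∏ j, ∏ k, y (b j k) (u + 2 * (j - k)) := by
  have : tableauWeight y u (rowsContaining b) = ∏ j, ∏ p ∈ Finset.univ.map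
      ⟨b j, (hb j).injective⟩, y p (u + 2 * (j - rowCount (rowsContaining b) p j)) := by
    refine Finset.prod_comm' fun p j => ?_
    simp [rowsContaining]
  rw [this]
  refine Finset.prod_congr rfl fun j _ => ?_
  rw [Finset.prod_map]
  refine Finset.prod_congr rfl fun k _ => ?_
  simp only [Function.Embedding.coeFn_mk, rowCount_rowsContaining_apply b hb]

open Classical in
/-- The **Jacobi–Trudi formula** for rectangles with arbitrary content-dependent weights. -/
theorem sum_rectangle_eq_jacobiTrudi (y : ℕ → ℤ → K) (m a n : ℕ) (u : ℤ) :
    ∑ b : Fin m → Fin a → Fin n with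
        (∀ j, StrictMono (b j)) ∧ ∀ k, Monotone fun j => b j k,
      ∏ j, ∏ k, y (b j k) (u + 2 * (j - k))
      = jacobiTrudi y n (fun _ : Fin m => (a : ℤ)) u := by
  rw [← sum_tableauWeight y n _ antitone_const]
  refine Finset.sum_bij (fun b _ => rowsContaining b) ?_ ?_ ?_ ?_
  · intro b hb
    simp only [Finset.mem_filter, Finset.mem_univ, true_and] at hb ⊢
    exact (isTableau_rowsContaining b hb.1).2 hb.2
  · intro b hb b' hb' h
    simp only [Finset.mem_filter, Finset.mem_univ, true_and] at hb hb'
    ext1 j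
    rw [← (hb.1 j).range_inj (hb'.1 j)]
    ext p
    have := congrArg (fun S => j ∈ S p) h
    simpa [rowsContaining] using this
  · intro S hS
    simp only [Finset.mem_filter, Finset.mem_univ, true_and] at hS
    have hcard : ∀ j, (Finset.univ.filter fun q : Fin n => j ∈ S q).card = a := by
      intro j
      have := congrFun hS.2 j
      simpa [rowCount] using this
    -- Row `j` of the inverse lists in increasing order the letters whose row set contains `j`.
    let b : Fin m → Fin a → Fin n := fun j =>
      (Finset.univ.filter fun q : Fin n => j ∈ S q).orderEmbOfFin (hcard j)
    have hb : ∀ j, StrictMono (b j) := fun j => OrderEmbedding.strictMono _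
    have hbS : rowsContaining b = S := by
      ext p j
      have := Set.ext_iff.1 (Finset.range_orderEmbOfFin _ (hcard j)) p
      simpa only [rowsContaining, b, Set.mem_range, Finset.mem_coe, Finset.mem_filter,
        Finset.mem_univ, true_and] using this
    refine ⟨b, ?_, hbS⟩
    simp only [Finset.mem_filter, Finset.mem_univ, true_and]
    refine ⟨hb, (isTableau_rowsContaining b hb).1 ?_⟩
    rw [hbS]
    exact hS
  · intro b hb
    simp only [Finset.mem_filter, Finset.mem_univ, true_and] at hb
    exact (tableauWeight_rowsContaining y b hb.1 u).symm

/-- The T-system for Jacobi–Trudi determinants of rectangles. -/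
theorem jacobiTrudi_rectangle_mul (y : ℕ → ℤ → K) (n m : ℕ) (a u : ℤ) :
    jacobiTrudi y n (fun _ : Fin (m + 1) => a) (u + 2)
        * jacobiTrudi y n (fun _ : Fin (m + 1) => a) u
      = jacobiTrudi y n (fun _ : Fin (m + 2) => a) u
          * jacobiTrudi y n (fun _ : Fin m => a) (u + 2)
        + jacobiTrudi y n (fun _ : Fin (m + 1) => a - 1) u
          * jacobiTrudi y n (fun _ : Fin (m + 1) => a + 1) (u + 2) := by
  -- Deleting the first row lowers `a` by one; deleting the first column raises `a` by one and `u`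
  -- by two; deleting the last row or column changes neither.
  have key := Matrix.desnanot_jacobi
    (Matrix.of fun i j : Fin (m + 2) => elemSum y n (a - i + j) (u + 2 * j))
  simp only [jacobiTrudi]
  convert key using 3 <;> (try refine congrArg Matrix.det ?_) <;> ext i j <;>
    simp only [Matrix.submatrix_apply, Matrix.of_apply, Fin.val_succ, Fin.val_castSucc,
      Nat.cast_add, Nat.cast_one] <;>
    congr 1 <;> ring

end Tableaux

/-! ### Duality between degrees `r` and `2s + 1 - r`. -/

section Duality

variable {K : Type*} [Field K]

/-- The letter `k + 1`, with the vacuum part reduced to its sign. -/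
def plainLetter (z : ℕ → K) (q : ℕ → ℤ → K) (k : ℕ) (c : ℤ) : K :=
  z k * (q k (c + k + 2) * q (k + 1) (c + k - 1) / (q k (c + k) * q (k + 1) (c + k + 1)))

/-- The letter `0`, with trivial vacuum part. -/
def zeroLetter (s : ℕ) (q : ℕ → ℤ → K) (c : ℤ) : K :=
  q s (c + s - 1) * q s (c + s + 2) / (q s (c + s + 1) * q s (c + s))

/-- The letter `k + 1` with a bar, with the vacuum part reduced to its sign. -/
def barLetter (s : ℕ) (z : ℕ → K) (q : ℕ → ℤ → K) (k : ℕ) (c : ℤ) : K :=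
  z k * (q k (c - k + 2 * s - 1) * q (k + 1) (c - k + 2 * s + 2)
    / (q k (c - k + 2 * s + 1) * q (k + 1) (c - k + 2 * s)))

/-- The alphabet `1, …, s, 0, s̄, …, 1̄`. -/
def ospLetter (s : ℕ) (z : ℕ → K) (q : ℕ → ℤ → K) (p : ℕ) : ℤ → K :=
  if p < s then plainLetter z q p
  else if p = s then zeroLetter s q
  else barLetter s z q (2 * s - p)

/-- The ratio of the elementary sums of complementary degrees. -/
def dualFactor (s : ℕ) (q : ℕ → ℤ → K) (k : ℕ) (r c : ℤ) : K :=
  q k (c + k + 1 + r) * q k (c + 2 * s - k - r)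
    / (q k (c + 2 * s - k + 2 - r) * q k (c + k + r - 1))

/-- The arguments `c + r - 1, …, c - r + 1` are centred at `c`. The four terms record which of the
two outer letters occur, and each inner sum is again centred, at `c` or `c ∓ 1`. -/
theorem elemSum_peel (y : ℕ → ℤ → K) (n : ℕ) (r c : ℤ) :
    elemSum y (n + 2) r (c + r - 1)
      = elemSum (fun p => y (p + 1)) n r (c + r - 1)
        + y 0 (c + r - 1) * elemSum (fun p => y (p + 1)) n (r - 1) (c - 1 + (r - 1) - 1)
        + y (n + 1) (c - r + 1) * (elemSum (fun p => y (p + 1)) n (r - 1) (c + 1 + (r - 1) - 1)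
          + y 0 (c + r - 1) * elemSum (fun p => y (p + 1)) n (r - 2) (c + (r - 2) - 1)) := by
  rw [elemSum_succ, elemSum_succ', elemSum_succ']
  rw [show c + r - 1 - 2 = c - 1 + (r - 1) - 1 by ring,
    show c + r - 1 - 2 * (r - 1) = c - r + 1 by ring,
    show c + (r - 2) - 1 = c - 1 + (r - 1) - 1 by ring,
    show c + 1 + (r - 1) - 1 = c + r - 1 by ring, show r - 1 - 1 = r - 2 by ring]

section
variable {s : ℕ} {z : ℕ → K} {q : ℕ → ℤ → K} {k t : ℕ}

/-- This and the next three identities match the four terms of `elemSum_peel` under duality: "only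
the first" and "only the last" go to themselves, while "both" and "neither" are exchanged. -/
theorem plainLetter_mul_dualFactor (hq : ∀ a c, q a c ≠ 0)
    (hs : k + (t + 1) = s) (r c : ℤ) :
    plainLetter z q k (c + r - 1) * dualFactor s q (k + 1) (r - 1) (c - 1)
      = dualFactor s q k r c * plainLetter z q k (c + (2 * t + 3 - r) - 1) := by
  subst hs
  simp only [plainLetter, dualFactor]
  push_cast
  ring_nf
  field_simp [hq]

theorem barLetter_mul_dualFactor (hq : ∀ a c, q a c ≠ 0)
    (hs : k + (t + 1) = s) (r c : ℤ) :
    barLetter s z q k (c - r + 1) * dualFactor s q (k + 1) (r - 1) (c + 1)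
      = dualFactor s q k r c * barLetter s z q k (c - (2 * t + 3 - r) + 1) := by
  subst hs
  simp only [barLetter, dualFactor]
  push_cast
  ring_nf
  field_simp [hq]

theorem plainLetter_mul_barLetter_mul_dualFactor (hq : ∀ a c, q a c ≠ 0)
    (hz : ∀ a, z a * z a = 1) (hs : k + (t + 1) = s) (r c : ℤ) :
    plainLetter z q k (c + r - 1) * barLetter s z q k (c - r + 1)
        * dualFactor s q (k + 1) (r - 2) c
      = dualFactor s q k r c := by
  subst hs
  have h := hz k
  simp only [plainLetter, barLetter, dualFactor]
  push_cast
  ring_nf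
  field_simp [hq]
  linear_combination h

theorem dualFactor_mul_plainLetter_mul_barLetter (hq : ∀ a c, q a c ≠ 0)
    (hz : ∀ a, z a * z a = 1) (hs : k + (t + 1) = s) (r c : ℤ) :
    dualFactor s q (k + 1) r c
      = dualFactor s q k r c * (plainLetter z q k (c + (2 * t + 3 - r) - 1)
        * barLetter s z q k (c - (2 * t + 3 - r) + 1)) := by
  subst hs
  have h := hz k
  simp only [plainLetter, barLetter, dualFactor]
  push_cast
  ring_nf
  field_simp [hq]
  linear_combination -h
end

theorem elemSum_ospLetter_dual {s : ℕ} {z : ℕ → K} {q : ℕ → ℤ → K} (hq : ∀ a c, q a c ≠ 0)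
    (hz : ∀ a, z a * z a = 1) (t k : ℕ) (hs : k + t = s) (r c : ℤ) :
    elemSum (fun p => ospLetter s z q (k + p)) (2 * t + 1) r (c + r - 1)
      = dualFactor s q k r c
        * elemSum (fun p => ospLetter s z q (k + p)) (2 * t + 1) (2 * t + 1 - r)
          (c + (2 * t + 1 - r) - 1) := by
  induction t generalizing k r c with
  | zero =>
    -- Only the letter `0` remains: degrees `0` and `1` are exchanged, and all other degrees vanish
    -- on both sides.
    obtain rfl : k = s := by omega
    have h0 : ospLetter k z q (k + 0) = zeroLetter k q := by simp [ospLetter]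
    simp only [mul_zero, zero_add, elemSum_succ, elemSum_zero, h0, zeroLetter, dualFactor,
      CharP.cast_eq_zero]
    rcases eq_or_ne r 0 with rfl | h0
    · norm_num
      ring_nf
      field_simp [hq]
    · rcases eq_or_ne r 1 with rfl | h1
      · norm_num
        ring_nf
      · have h2 : r - 1 ≠ 0 := by omega
        have h3 : 1 - r ≠ 0 := by omega
        simp [h0, h2, h3]
  | succ t ih =>
    have hA : ospLetter s z q (k + 0) = plainLetter z q k := by
      rw [ospLetter, if_pos (by omega), add_zero]
    have hB : ospLetter s z q (k + (2 * t + 1 + 1)) = barLetter s z q k := by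
      rw [ospLetter, if_neg (by omega), if_neg (by omega)]
      congr 1
      omega
    have hin : (fun p => ospLetter s z q (k + (p + 1))) = fun p => ospLetter s z q (k + 1 + p) := by
      funext p
      congr 1
      omega
    have ih' := ih (k + 1) (by omega)
    rw [show 2 * (t + 1) + 1 = 2 * t + 1 + 2 by ring, elemSum_peel, elemSum_peel]
    simp only [hA, hB, hin]
    have hn : (2 * ((t + 1 : ℕ) : ℤ) + 1 - r) = 2 * t + 3 - r := by push_cast; ring
    rw [hn, ih' r c, ih' (r - 1) (c - 1), ih' (r - 1) (c + 1), ih' (r - 2) c]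
    have e1 := plainLetter_mul_dualFactor (z := z) hq hs r c
    have e2 := barLetter_mul_dualFactor (z := z) hq hs r c
    have e3 := plainLetter_mul_barLetter_mul_dualFactor hq hz hs r c
    have e4 := dualFactor_mul_plainLetter_mul_barLetter hq hz hs r c
    rw [show 2 * (t : ℤ) + 1 - (r - 1) = 2 * t + 3 - r - 1 by ring,
      show 2 * (t : ℤ) + 1 - (r - 2) = 2 * t + 3 - r by ring,
      show 2 * (t : ℤ) + 1 - r = 2 * t + 3 - r - 2 by ring]
    linear_combination
      (elemSum (fun p => ospLetter s z q (k + 1 + p)) (2 * t + 1) (2 * t + 3 - r - 2)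
        (c + (2 * t + 3 - r - 2) - 1)) * e4
      + (elemSum (fun p => ospLetter s z q (k + 1 + p)) (2 * t + 1) (2 * t + 3 - r - 1)
        (c - 1 + (2 * t + 3 - r - 1) - 1)) * e1
      + (elemSum (fun p => ospLetter s z q (k + 1 + p)) (2 * t + 1) (2 * t + 3 - r - 1)
        (c + 1 + (2 * t + 3 - r - 1) - 1)) * e2
      + (elemSum (fun p => ospLetter s z q (k + 1 + p)) (2 * t + 1) (2 * t + 3 - r)
        (c + (2 * t + 3 - r) - 1)) * e3

theorem prod_fin_div_telescope (f : ℤ → K) (hf : ∀ c, f c ≠ 0) (m : ℕ) (u : ℤ) :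
    ∏ j : Fin m, (f (u + 2 * j + 2) / f (u + 2 * j)) = f (u + 2 * m) / f u := by
  induction m with
  | zero => simp [hf]
  | succ m ih =>
    rw [Fin.prod_univ_castSucc]
    simp only [Fin.val_castSucc, Fin.val_last]
    rw [ih, show u + 2 * ((m + 1 : ℕ) : ℤ) = u + 2 * m + 2 by push_cast; ring]
    field_simp [hf]

/-- For `k = 0` the ratio at entry `(i, j)` is a function of `j` times a function of `i`. Both come
out of the determinant as telescoping products, leaving the transposed matrix for the dual width. -/
theorem jacobiTrudi_ospLetter_dual {s : ℕ} {z : ℕ → K} {q : ℕ → ℤ → K} (hq : ∀ a c, q a c ≠ 0)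
    (hz : ∀ a, z a * z a = 1) (m : ℕ) (a u : ℤ) :
    jacobiTrudi (ospLetter s z q) (2 * s + 1) (fun _ : Fin m => a) u
      = q 0 (u + 2 * m) / q 0 u * (q 0 (u - 2 * a + 2 * s + 1) / q 0 (u + 2 * m - 2 * a + 2 * s + 1))
        * jacobiTrudi (ospLetter s z q) (2 * s + 1) (fun _ : Fin m => 2 * s + 1 - a)
          (u + 2 * s + 1 - 2 * a) := by
  have hcol := prod_fin_div_telescope (q 0) (hq 0) m u
  have hrow := prod_fin_div_telescope (fun c => (q 0 c)⁻¹) (fun c => inv_ne_zero (hq 0 c)) m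
    (u - 2 * a + 2 * s + 1)
  have key := elemSum_ospLetter_dual hq hz s 0 (zero_add s)
  simp only [zero_add] at key
  simp only [inv_div_inv] at hrow
  have hmat : (Matrix.of fun i j : Fin m =>
      elemSum (ospLetter s z q) (2 * s + 1) (a - i + j) (u + 2 * j))
      = Matrix.of fun i j : Fin m => (q 0 (u + 2 * j + 2) / q 0 (u + 2 * j)) * Matrix.of (fun i j : Fin m =>
        q 0 (u - 2 * a + 2 * s + 1 + 2 * i) / q 0 (u - 2 * a + 2 * s + 1 + 2 * i + 2)
        * (Matrix.of fun i j : Fin m => elemSum (ospLetter s z q) (2 * s + 1)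
          (2 * s + 1 - a - i + j) (u + 2 * s + 1 - 2 * a + 2 * j)).transpose i j) i j := by
    ext i j
    simp only [Matrix.transpose_apply, Matrix.of_apply]
    -- The centre is chosen so that `c + r - 1` equals the argument `u + 2 j` of the entry.
    have h := key (a - i + j) (u + i + j - a + 1)
    rw [show u + i + j - a + 1 + (a - i + j) - 1 = u + 2 * j by ring] at h
    rw [h, dualFactor, ← mul_assoc, div_mul_div_comm]
    congr 2
    · push_cast
      ring_nf
    · push_cast
      ring_nf
    · ring
    · ring
  rw [← hcol, show u + 2 * (m : ℤ) - 2 * a + 2 * s + 1 = u - 2 * a + 2 * s + 1 + 2 * m by ring,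
    ← hrow, jacobiTrudi, jacobiTrudi, hmat, Matrix.det_mul_row, Matrix.det_mul_column,
    Matrix.det_transpose, mul_assoc]

end Duality

/-! ### Specialisation to the dressed vacuum forms. -/

namespace OspData

variable (D : OspData) {K : Type*} [Field K] [Algebra ℂ K]

theorem hi_add (a b : ℤ) : hi K (a + b) = hi K a + hi K b := by
  simp only [hi, ← map_add]
  congr 1
  push_cast
  ring

theorem hi_sub (a b : ℤ) : hi K (a - b) = hi K a - hi K b := by
  simp only [hi, ← map_sub]
  congr 1
  push_cast
  ring

theorem add_hi_add (v : K) (a b : ℤ) : v + hi K a + hi K b = v + hi K (a + b) := by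
  rw [hi_add, add_assoc]

theorem add_hi_sub (v : K) (a b : ℤ) : v + hi K a - hi K b = v + hi K (a - b) := by
  rw [hi_sub, add_sub_assoc]

theorem hi_zero : hi K 0 = 0 := by simp [hi]

theorem zeta_mul_self {F : Type*} [Field F] (a : ℕ) : D.zeta F a * D.zeta F a = 1 := by
  have h : ∀ n : ℤ, ((-1 : F) ^ n) * (-1) ^ n = 1 := by
    intro n
    rw [← mul_zpow]
    simp
  unfold zeta
  split_ifs <;> exact h _

section
variable (v : K)

/-- `φ₋` at the point `v + c i / 2`. -/
noncomputable def phiMAt (c : ℤ) : K := D.phiM (v + hi K c)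

/-- `φ₊` at the point `v + c i / 2`. -/
noncomputable def phiPAt (c : ℤ) : K := D.phiP (v + hi K c)

theorem phiM_add_hi (c : ℤ) : D.phiM (v + hi K c) = D.phiMAt v c := rfl

theorem phiP_add_hi (c : ℤ) : D.phiP (v + hi K c) = D.phiPAt v c := rfl

/-- The functions `Q_a` at the point `v + c i / 2`, with `Q_0` replaced by a function that
generates the vacuum parts. -/
noncomputable def dressedQ (a : ℕ) (c : ℤ) : K :=
  if a = 0 then D.phiMAt v c * D.phiPAt v (c - 2 * D.s - 1) else D.Q a (v + hi K c)

theorem dressedQ_zero (c : ℤ) :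
    D.dressedQ v 0 c = D.phiMAt v c * D.phiPAt v (c - 2 * D.s - 1) := rfl

theorem dressedQ_of_ne_zero {a : ℕ} (ha : a ≠ 0) (c : ℤ) :
    D.dressedQ v a c = D.Q a (v + hi K c) := if_neg ha

variable {v}

theorem phiMAt_ne_zero (hv : ∀ c : ℂ, v + algebraMap ℂ K c ≠ 0)
    (c : ℤ) : D.phiMAt v c ≠ 0 := by
  refine pow_ne_zero _ ?_
  rw [hi, add_sub_assoc, ← map_sub]
  exact hv _

theorem phiPAt_ne_zero (hv : ∀ c : ℂ, v + algebraMap ℂ K c ≠ 0)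
    (c : ℤ) : D.phiPAt v c ≠ 0 := by
  refine pow_ne_zero _ ?_
  rw [hi, add_assoc, ← map_add]
  exact hv _

theorem dressedQ_ne_zero (hv : ∀ c : ℂ, v + algebraMap ℂ K c ≠ 0)
    (a : ℕ) (c : ℤ) : D.dressedQ v a c ≠ 0 := by
  unfold dressedQ
  split_ifs with h
  · exact mul_ne_zero (D.phiMAt_ne_zero hv _) (D.phiPAt_ne_zero hv _)
  · rw [Q, if_neg h]
    refine Finset.prod_ne_zero_iff.2 fun k _ => ?_
    rw [hi, add_sub_assoc, ← map_sub]
    exact hv _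

theorem boxPlain_eq (hv : ∀ c : ℂ, v + algebraMap ℂ K c ≠ 0)
    (k : ℕ) (c : ℤ) :
    D.boxPlain (k + 1) (v + hi K c) = D.phiPAt v c * D.phiMAt v c
      * plainLetter (fun k => D.zeta K (k + 1)) (D.dressedQ v) k c := by
  have hM := D.phiMAt_ne_zero hv
  have hP := D.phiPAt_ne_zero hv
  simp only [boxPlain, psi, plainLetter, add_hi_add, add_hi_sub, D.phiM_add_hi, D.phiP_add_hi,
    Nat.add_sub_cancel, ← D.dressedQ_of_ne_zero v k.add_one_ne_zero]
  rcases k with _ | k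
  -- The letter `1`: the quotient of dressed `Q_0`'s supplies exactly the extra `φ` factors of
  -- `ψ_1`.
  · simp only [dressedQ_zero, Q, if_true, zero_add]
    push_cast
    ring_nf
    field_simp [hM, hP]
  · rw [if_neg (by omega), D.dressedQ_of_ne_zero v k.add_one_ne_zero,
      D.dressedQ_of_ne_zero v k.add_one_ne_zero]
    push_cast
    ring_nf

theorem boxBar_eq (hv : ∀ c : ℂ, v + algebraMap ℂ K c ≠ 0)
    (k : ℕ) (c : ℤ) :
    D.boxBar (k + 1) (v + hi K c) = D.phiPAt v c * D.phiMAt v c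
      * barLetter D.s (fun k => D.zeta K (k + 1)) (D.dressedQ v) k c := by
  have hM := D.phiMAt_ne_zero hv
  have hP := D.phiPAt_ne_zero hv
  simp only [boxBar, psiBar, barLetter, add_hi_add, add_hi_sub, D.phiM_add_hi, D.phiP_add_hi,
    Nat.add_sub_cancel, ← D.dressedQ_of_ne_zero v k.add_one_ne_zero]
  rcases k with _ | k
  · simp only [dressedQ_zero, Q, if_true, zero_add]
    push_cast
    ring_nf
    field_simp [hM, hP]
  · rw [if_neg (by omega), D.dressedQ_of_ne_zero v k.add_one_ne_zero,
      D.dressedQ_of_ne_zero v k.add_one_ne_zero]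
    push_cast
    ring_nf

theorem box_eq (hv : ∀ c : ℂ, v + algebraMap ℂ K c ≠ 0)
    (hs : 1 ≤ D.s) (p : D.Letter) (c : ℤ) :
    D.box p (v + hi K c) = D.phiPAt v c * D.phiMAt v c
      * ospLetter D.s (fun k => D.zeta K (k + 1)) (D.dressedQ v) p c := by
  have hp := p.2
  unfold box ospLetter
  split_ifs with h1 h2
  · exact D.boxPlain_eq hv _ c
  -- Since `s ≥ 1`, the function `Q_s` in this box is not the one that was replaced.
  · simp only [boxZero, psiZero, zeroLetter, add_hi_add, D.phiM_add_hi, D.phiP_add_hi,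
      ← D.dressedQ_of_ne_zero v (Nat.one_le_iff_ne_zero.1 hs), add_sub_assoc]
    simp only [add_assoc]
  · rw [show 2 * D.s + 1 - (p : ℕ) = 2 * D.s - p + 1 by omega]
    exact D.boxBar_eq hv _ c

/-- The Jacobi–Trudi determinant of the rectangle with `m` rows and `a` columns. -/
noncomputable def rectangleDet (D : OspData) (v : K) (a : ℤ) (m : ℕ) (u : ℤ) : K :=
  jacobiTrudi (ospLetter D.s (fun k => D.zeta K (k + 1)) (D.dressedQ v)) (2 * D.s + 1)
    (fun _ : Fin m => a) u

theorem rectangleDet_def (a : ℤ) (m : ℕ) (u : ℤ) :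
    jacobiTrudi (ospLetter D.s (fun k => D.zeta K (k + 1)) (D.dressedQ v)) (2 * D.s + 1)
      (fun _ : Fin m => a) u = rectangleDet D v a m u := rfl

theorem dvf_eq (hv : ∀ c : ℂ, v + algebraMap ℂ K c ≠ 0)
    (hs : 1 ≤ D.s) (a m : ℕ) (c : ℤ) :
    D.dvf a m (v + hi K c) = (∏ j : Fin m, ∏ k : Fin a,
      (D.phiPAt v (c + a - m + 2 * (j - k)) * D.phiMAt v (c + a - m + 2 * (j - k))))
      * rectangleDet D v a m (c + a - m) := by
  classical
  rw [rectangleDet, ← sum_rectangle_eq_jacobiTrudi, dvf, Finset.mul_sum]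
  refine Finset.sum_congr (Finset.filter_congr fun b _ => Iff.rfl) fun b _ => ?_
  simp only [← Finset.prod_mul_distrib]
  refine Finset.prod_congr rfl fun j _ => Finset.prod_congr rfl fun k _ => ?_
  rw [add_hi_sub, D.box_eq hv hs]
  ring_nf

theorem T_eq (hv : ∀ c : ℂ, v + algebraMap ℂ K c ≠ 0)
    (hs : 1 ≤ D.s) (a m : ℕ) (c : ℤ) :
    D.T a m (v + hi K c) = rectangleDet D v a m (c + a - m)
      * (D.phiMAt v (c + a - m) * D.phiPAt v (c - a + m)) := by
  have hne : (∏ j : Fin m, ∏ k : Fin a,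
      (D.phiPAt v (c + a - m + 2 * (j - k)) * D.phiMAt v (c + a - m + 2 * (j - k)))) ≠ 0 :=
    Finset.prod_ne_zero_iff.2 fun j _ => Finset.prod_ne_zero_iff.2 fun k _ =>
      mul_ne_zero (D.phiPAt_ne_zero hv _) (D.phiMAt_ne_zero hv _)
  have hnorm : D.norm a m (v + hi K c) = (∏ j : Fin m, ∏ k : Fin a,
      (D.phiPAt v (c + a - m + 2 * (j - k)) * D.phiMAt v (c + a - m + 2 * (j - k))))
      / (D.phiMAt v (c + a - m) * D.phiPAt v (c - a + m)) := by
    simp only [norm, add_hi_sub, add_hi_add, D.phiM_add_hi, D.phiP_add_hi]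
    congr 1
    · refine Finset.prod_congr rfl fun j _ => Finset.prod_congr rfl fun k _ => ?_
      rw [mul_comm]
      ring_nf
    · ring_nf
  rw [T, D.dvf_eq hv hs, hnorm]
  have h1 := D.phiMAt_ne_zero hv (c + a - m)
  have h2 := D.phiPAt_ne_zero hv (c - a + m)
  field_simp

theorem T_mul_T (hv : ∀ c : ℂ, v + algebraMap ℂ K c ≠ 0)
    (hs : 1 ≤ D.s) (a m : ℕ) :
    D.T (a + 1) (m + 1) (v + hi K 1) * D.T (a + 1) (m + 1) (v - hi K 1)
      = D.T (a + 1) (m + 2) v * D.T (a + 1) m v + D.T a (m + 1) v * D.T (a + 2) (m + 1) v := by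
  have h0 : v + hi K 0 = v := by rw [hi_zero, add_zero]
  have h1 : v - hi K 1 = v + hi K (-1) := by
    rw [← h0, add_hi_sub, zero_sub, h0]
  rw [h1]
  nth_rewrite 3 4 5 6 [← h0]
  simp only [D.T_eq hv hs]
  have key := jacobiTrudi_rectangle_mul
    (ospLetter D.s (fun k => D.zeta K (k + 1)) (D.dressedQ v)) (2 * D.s + 1) m
    (a + 1) (a - m - 1)
  simp only [D.rectangleDet_def] at key
  push_cast
  ring_nf at key ⊢
  -- All three products of `T`'s carry these same four `φ` factors.
  linear_combination D.phiMAt v (1 + a - m) * D.phiPAt v (1 - a + m)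
    * D.phiMAt v (-1 + a - m) * D.phiPAt v (-1 - a + m) * key

theorem T_succ_s (hv : ∀ c : ℂ, v + algebraMap ℂ K c ≠ 0)
    (hs : 1 ≤ D.s) (m : ℕ) :
    D.T (D.s + 1) m v = D.g m v * D.T D.s m v := by
  have h0 : v + hi K 0 = v := by rw [hi_zero, add_zero]
  have hM := D.phiMAt_ne_zero hv
  have hP := D.phiPAt_ne_zero hv
  -- Width `s + 1` is dual to width `s`; the telescoped dressed `Q_0`'s, with the `φ` prefactors of
  -- `T_eq`, produce `g`.
  have key := jacobiTrudi_ospLetter_dual (D.dressedQ_ne_zero hv) (z := fun k => D.zeta K (k + 1))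
    (fun a => D.zeta_mul_self _) m (s := D.s) (D.s + 1) (D.s + 1 - m)
  simp only [D.rectangleDet_def, dressedQ_zero] at key
  rw [← h0, D.T_eq hv hs, D.T_eq hv hs, g]
  simp only [add_hi_add, add_hi_sub, D.phiM_add_hi, D.phiP_add_hi]
  push_cast
  ring_nf at key ⊢
  rw [key]
  field_simp [hM, hP]

theorem T_zero_right (hv : ∀ c : ℂ, v + algebraMap ℂ K c ≠ 0)
    (hs : 1 ≤ D.s) (a : ℕ) :
    D.T a 0 v = D.phiM (v + hi K a) * D.phiP (v - hi K a) := by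
  have h0 : v + hi K 0 = v := by rw [hi_zero, add_zero]
  have h := D.T_eq hv hs a 0 0
  have h1 : v - hi K a = v + hi K (-a) := by
    rw [← zero_sub, hi_sub, hi_zero]; ring
  rw [h0] at h
  rw [h, h1, rectangleDet, jacobiTrudi, Matrix.det_fin_zero]
  simp [phiMAt, phiPAt]

theorem T_zero_left (hv : ∀ c : ℂ, v + algebraMap ℂ K c ≠ 0)
    (hs : 1 ≤ D.s) (m : ℕ) :
    D.T 0 m v = D.phiM (v - hi K m) * D.phiP (v + hi K m) := by
  classical
  have h0 : v + hi K 0 = v := by rw [hi_zero, add_zero]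
  have h := D.T_eq hv hs 0 m 0
  have h1 : v - hi K m = v + hi K (-m) := by
    rw [← zero_sub, hi_sub, hi_zero]; ring
  rw [h0] at h
  rw [h, h1, rectangleDet, ← sum_rectangle_eq_jacobiTrudi, Finset.filter_true_of_mem]
  · simp [phiMAt, phiPAt]
  · intro b _
    exact ⟨fun j => Subsingleton.strictMono _, fun k => k.elim0⟩

end
end OspData

theorem mainTheorem3 (D : OspData) (hs : 1 ≤ D.s) (hN : Even D.N)
    (v : RatFunc ℂ) (hv : v = RatFunc.X) :
    (∀ a : ℕ, 1 ≤ a → a < D.s → ∀ m : ℕ, 1 ≤ m →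
      D.T a m (v + OspData.hi _ 1) * D.T a m (v - OspData.hi _ 1)
        = D.T a (m + 1) v * D.T a (m - 1) v + D.T (a - 1) m v * D.T (a + 1) m v) ∧
    (∀ m : ℕ, 1 ≤ m →
      D.T D.s m (v + OspData.hi _ 1) * D.T D.s m (v - OspData.hi _ 1)
        = D.T D.s (m + 1) v * D.T D.s (m - 1) v
          + D.g m v * D.T (D.s - 1) m v * D.T D.s m v) ∧
    (∀ a : ℕ, 1 ≤ a →
      D.T a 0 v = D.phiM (v + OspData.hi _ a) * D.phiP (v - OspData.hi _ a)) ∧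
    (∀ m : ℕ, 1 ≤ m →
      D.T 0 m v = D.phiM (v - OspData.hi _ m) * D.phiP (v + OspData.hi _ m)) := by
  -- The indeterminate differs from every constant, so no `Q_a` or `φ` in a denominator vanishes.
  have hne : ∀ c : ℂ, v + algebraMap ℂ (RatFunc ℂ) c ≠ 0 := by
    intro c
    rw [hv, ← RatFunc.algebraMap_X, IsScalarTower.algebraMap_apply ℂ (Polynomial ℂ) (RatFunc ℂ),
      ← map_add]
    exact (map_ne_zero_iff _ (FaithfulSMul.algebraMap_injective (Polynomial ℂ) (RatFunc ℂ))).2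
      (Polynomial.X_add_C_ne_zero c)
  have hT : ∀ a : ℕ, 1 ≤ a → ∀ m : ℕ, 1 ≤ m →
      D.T a m (v + OspData.hi _ 1) * D.T a m (v - OspData.hi _ 1)
        = D.T a (m + 1) v * D.T a (m - 1) v + D.T (a - 1) m v * D.T (a + 1) m v := by
    intro a ha m hm
    obtain ⟨a, rfl⟩ := Nat.exists_eq_add_of_le' ha
    obtain ⟨m, rfl⟩ := Nat.exists_eq_add_of_le' hm
    exact D.T_mul_T hne hs a m
  refine ⟨fun a ha _ m hm => hT a ha m hm, fun m hm => ?_, fun a _ => D.T_zero_right hne hs a,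
    fun m _ => D.T_zero_left hne hs m⟩
  rw [hT D.s hs m hm, D.T_succ_s hne hs m]
  ring
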